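/- Let $N\ge 1$, let $\mathbb P=[p_{ij}]\in\mathbb R^{N\times N}$ be a transition probability matrix (nonnegative entries, rows summing to $1$), and let $M_1,\dots,M_N\in\mathbb R^{d\times d}$. For $\sigma_0\in\{1,\dots,N\}$ let $\{\sigma_k\}_{k\ge 0}$ be a time-homogeneous Markov chain on $\{1,\dots,N\}$ with transition matrix $\mathbb P$ and constant initial state $\sigma_0$, and put $A_k=M_{\sigma_k}$. For a positive integer $p$ and a norm $\|\cdot\|$ on $\mathbb R^{d\times d}$, the $p$-radius ($L^p$-norm joint spectral radius) of the process $A=\{A_k\}$ is $$\rho_{p,A}=\rho_{p,A}(\sigma_0)=\lim_{k\to\infty}\bigl(E[\|A_k\cdots A_1\|^p]\bigr)^{1/(pk)} .$$ Let $M^{\otimes p}$ be the $p$-th Kronecker power, $\rho(\cdot)$ the spectral radius of a matrix, and $$T_p=(\mathbb P^\top\otimes I_{d^p})\,\mathrm{diag}(M_1^{\otimes p},\dots,M_N^{\otimes p})\in\mathbb R^{Nd^p\times Nd^p}.$$ Assume that either $p=2$, or $p=1$ and there is a proper cone $K\subset\mathbb R^d$ (closed under multiplication by nonnegative scalars, closed,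 convex, with nonempty interior, and such that $x,-x\in K$ implies $x=0$) with $M_iK\subset K$ for all $i$. Then, for every norm, the limit defining $\rho_{p,A}(\sigma_0)$ exists for every $\sigma_0$, and $$\max_{\sigma_0\in\{1,\dots,N\}}\rho_{p,A}(\sigma_0)=\rho(T_p)^{1/p}.$$ Moreover, if all $p_{ij}$ are positive, or if $\mathbb P$ is irreducible (for all $i,j$ there is $n\ge 0$ with $(\mathbb P^n)_{ij}>0$) and every $M_i$ is invertible, then $\rho_{p,A}(\sigma_0)=\rho(T_p)^{1/p}$ for every initial state $\sigma_0$. -/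

import Mathlib

open scoped Topology Kronecker
open Filter MeasureTheory

namespace MarkovSwitched

/-- A proper cone of `ℝ^d`: closed under multiplication by nonnegative scalars, closed, convex,
solid (nonempty interior) and pointed. -/
structure IsProperCone {d : ℕ} (K : Set (Fin d → ℝ)) : Prop where
  smul_mem : ∀ c : ℝ, 0 ≤ c → ∀ x ∈ K, c • x ∈ K
  isClosed : IsClosed K
  convex : Convex ℝ K
  solid : (interior K).Nonempty
  pointed : ∀ x, x ∈ K → -x ∈ K → x = 0

/-- The matrix `M` maps the set `K` into itself. -/
def LeavesInvariant {d : ℕ} (M : Matrix (Fin d) (Fin d) ℝ) (K : Set (Fin d → ℝ)) : Prop :=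
  ∀ x ∈ K, M.mulVec x ∈ K

/-- The `p`-th Kronecker power of a `d × d` matrix, a matrix of size `d^p × d^p` whose rows and
columns are indexed by the multi-indices `(i_1, …, i_p)`. -/
def kronPow {d : ℕ} (M : Matrix (Fin d) (Fin d) ℝ) (p : ℕ) :
    Matrix (Fin p → Fin d) (Fin p → Fin d) ℝ :=
  Matrix.of fun i j => ∏ l, M (i l) (j l)

theorem kronPow_one_apply {d : ℕ} (M : Matrix (Fin d) (Fin d) ℝ) (i j : Fin 1 → Fin d) :
    kronPow M 1 i j = M (i 0) (j 0) := by
  simp [kronPow]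

/-- The recursion `M^{⊗(p+1)} = M^{⊗p} ⊗ M`, up to the identification of index sets. -/
theorem kronPow_succ {d : ℕ} (M : Matrix (Fin d) (Fin d) ℝ) (p : ℕ) :
    kronPow M (p + 1) =
      (kronPow M p ⊗ₖ M).submatrix (fun i => (Fin.init i, i (Fin.last p)))
        (fun i => (Fin.init i, i (Fin.last p))) := by
  ext i j
  simp [kronPow, Fin.prod_univ_castSucc, Fin.init]

/-- The matrix `T_p = (Pᵀ ⊗ I) diag(M_1^{⊗p}, …, M_N^{⊗p})` of size `N d^p × N d^p`. -/
def transferMatrix {N d : ℕ} (P : Matrix (Fin N) (Fin N) ℝ)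
    (M : Fin N → Matrix (Fin d) (Fin d) ℝ) (p : ℕ) :
    Matrix (Fin N × (Fin p → Fin d)) (Fin N × (Fin p → Fin d)) ℝ :=
  (P.transpose ⊗ₖ (1 : Matrix (Fin p → Fin d) (Fin p → Fin d) ℝ)) *
    (Matrix.blockDiagonal fun i => kronPow (M i) p).submatrix Prod.swap Prod.swap

/-- Entries of `T_p`: its `(j, i)` block is `p_{ij} M_i^{⊗p}`. -/
theorem transferMatrix_apply {N d : ℕ} (P : Matrix (Fin N) (Fin N) ℝ)
    (M : Fin N → Matrix (Fin d) (Fin d) ℝ) (p : ℕ) (j i : Fin N) (a b : Fin p → Fin d) :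
    transferMatrix P M p (j, a) (i, b) = P i j * kronPow (M i) p a b := by
  simp [transferMatrix, Matrix.mul_apply, Fintype.sum_prod_type, Matrix.blockDiagonal_apply,
    Matrix.one_apply]

/-- The spectral radius of a real square matrix: the largest modulus of a complex eigenvalue. -/
noncomputable def specRadius {n : Type*} [Fintype n] [DecidableEq n] (T : Matrix n n ℝ) : ℝ :=
  (spectralRadius ℂ (T.map (algebraMap ℝ ℂ))).toReal

/-- `σ` is a time-homogeneous Markov chain with state space `Fin N`, transition probability
matrix `P` and constant initial state `s₀` on the probability space `(Ω, μ)`. -/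
structure IsMarkovChain {N : ℕ} (P : Matrix (Fin N) (Fin N) ℝ) (s₀ : Fin N)
    {Ω : Type*} [MeasurableSpace Ω] (μ : Measure Ω) (σ : ℕ → Ω → Fin N) : Prop where
  measurable : ∀ k, Measurable (σ k)
  initial : ∀ᵐ ω ∂μ, σ 0 ω = s₀
  transition : ∀ (k : ℕ) (s : ℕ → Fin N),
    μ.real {ω | ∀ n ≤ k + 1, σ n ω = s n} =
      μ.real {ω | ∀ n ≤ k, σ n ω = s n} * P (s k) (s (k + 1))

/-- The product `A_k ⋯ A_1` (empty for `k = 0`). -/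
def revProd {d : ℕ} {Ω : Type*} (A : ℕ → Ω → Matrix (Fin d) (Fin d) ℝ) :
    ℕ → Ω → Matrix (Fin d) (Fin d) ℝ
  | 0, _ => 1
  | k + 1, ω => A (k + 1) ω * revProd A k ω

/-- The sequence `k ↦ (E[‖A_k ⋯ A_1‖^p])^{1/(pk)}`, for the norm `ν` on `d × d` matrices. -/
noncomputable def pRadiusSeq {d : ℕ} (ν : Matrix (Fin d) (Fin d) ℝ → ℝ) (p : ℕ)
    {Ω : Type*} [MeasurableSpace Ω] (μ : Measure Ω)
    (A : ℕ → Ω → Matrix (Fin d) (Fin d) ℝ) (k : ℕ) : ℝ :=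
  (∫ ω, ν (revProd A k ω) ^ p ∂μ) ^ (1 / ((p : ℝ) * (k : ℝ)))

/-- The `L^p`-norm joint spectral radius of the process `A`: the limit of `pRadiusSeq`
(meaningful when that sequence converges). -/
noncomputable def pRadius {d : ℕ} (ν : Matrix (Fin d) (Fin d) ℝ → ℝ) (p : ℕ)
    {Ω : Type*} [MeasurableSpace Ω] (μ : Measure Ω)
    (A : ℕ → Ω → Matrix (Fin d) (Fin d) ℝ) : ℝ :=
  limUnder atTop (pRadiusSeq ν p μ A)

end MarkovSwitched

/-!
Let `T'` be the matrix `T_p` with its two factors exchanged, which has the same spectral radius.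
The entries of `T' ^ k` in the columns of the state `s` are the expectations of the entries of
`(A_k ⋯ A_1)^{⊗p}` on the events `σ_k = j`, for the chain started at `s`. They are `O` of
`E[‖A_k ⋯ A_1‖ ^ p]` because every entry of a matrix is bounded by a multiple of its norm.
Conversely, `‖X‖ ^ p` is dominated by a linear functional of `X^{⊗p}`: for even `p` one sums the
`p`-th powers of the entries, and when `X` preserves a proper cone `K`, the functional
`X ↦ φ (X v)` with `v` interior to `K` and `φ` positive on `K \ {0}` dominates `‖X‖`. So the
`p`-radius is governed by the growth of the block column `T' ^ k w_s`, where `w_s` projects onto the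
block of `s`.

The orbit of a vector under a linear operator has an exact exponential growth rate: on the cyclic
subspace of the vector, the orbit grows like the powers of the operator, to which Gelfand's formula
applies. Since the `w_s` add up to the identity, the largest of the rates is the spectral radius.

Conditioning on the first step compares different initial states. If `P` is positive, the moments at
time `k + 1` are positive combinations of the same quantities for all initial states; if
`p_{st} > 0` and `M_t` is invertible, the rate at `s` is at least the rate at `t`, and
irreducibility propagates this to all pairs.
-/

namespace MarkovSwitched

section GrowthRate

variable {E F : Type*} [SeminormedAddCommGroup E] [SeminormedAddCommGroup F]

/-- The sequence `a` has exponential growth rate `l`: `‖a_k‖^{1/k} → l`. -/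
def HasGrowthRate (a : ℕ → E) (l : ℝ) : Prop :=
  Tendsto (fun k : ℕ => ‖a k‖ ^ (1 / (k : ℝ))) atTop (𝓝 l)

theorem HasGrowthRate.nonneg {a : ℕ → E} {l : ℝ} (ha : HasGrowthRate a l) : 0 ≤ l :=
  ge_of_tendsto' ha fun _ => by positivity

theorem HasGrowthRate.unique {a : ℕ → E} {l m : ℝ} (hl : HasGrowthRate a l)
    (hm : HasGrowthRate a m) : l = m :=
  tendsto_nhds_unique hl hm

theorem HasGrowthRate.tendsto_const_mul_rpow {a : ℕ → E} {l c : ℝ} (ha : HasGrowthRate a l)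
    (hc : 0 < c) : Tendsto (fun k : ℕ => (c * ‖a k‖) ^ (1 / (k : ℝ))) atTop (𝓝 l) := by
  have hconst : Tendsto (fun k : ℕ => c ^ (1 / (k : ℝ))) atTop (𝓝 1) := by
    simpa only [Real.rpow_zero] using
      tendsto_const_nhds.rpow tendsto_one_div_atTop_nhds_zero_nat (Or.inl hc.ne')
  simpa only [one_mul, Real.mul_rpow hc.le (norm_nonneg _)] using hconst.mul ha

theorem HasGrowthRate.le_of_isBigO {a : ℕ → E} {b : ℕ → F} {l m : ℝ} (ha : HasGrowthRate a l)
    (hb : HasGrowthRate b m) (hab : a =O[atTop] b) : l ≤ m := by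
  obtain ⟨C, hC, hle⟩ := hab.exists_pos
  exact le_of_tendsto_of_tendsto ha (hb.tendsto_const_mul_rpow hC) <|
    hle.bound.mono fun k hk => Real.rpow_le_rpow (norm_nonneg _) hk (by positivity)

theorem HasGrowthRate.of_isTheta {a : ℕ → E} {b : ℕ → F} {l : ℝ} (hb : HasGrowthRate b l)
    (hab : a =Θ[atTop] b) : HasGrowthRate a l := by
  obtain ⟨C, hC, hle⟩ := hab.isBigO.exists_pos
  obtain ⟨D, hD, hge⟩ := hab.isBigO_symm.exists_pos
  refine tendsto_of_tendsto_of_tendsto_of_le_of_le' (hb.tendsto_const_mul_rpow (inv_pos.2 hD))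
    (hb.tendsto_const_mul_rpow hC) (hge.bound.mono fun k hk => ?_) (hle.bound.mono fun k hk => ?_)
  · exact Real.rpow_le_rpow (by positivity) ((inv_mul_le_iff₀ hD).2 hk) (by positivity)
  · exact Real.rpow_le_rpow (norm_nonneg _) hk (by positivity)

theorem HasGrowthRate.comp_add_one {a : ℕ → E} {l : ℝ} (ha : HasGrowthRate a l) :
    HasGrowthRate (fun k => a (k + 1)) l := by
  have hexp : Tendsto (fun k : ℕ => 1 + 1 / (k : ℝ)) atTop (𝓝 1) := by
    simpa using tendsto_const_nhds.add (tendsto_one_div_atTop_nhds_zero_nat (𝕜 := ℝ))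
  have hpow := (ha.comp (tendsto_add_atTop_nat 1)).rpow hexp (Or.inr one_pos)
  rw [Real.rpow_one] at hpow
  refine hpow.congr' ?_
  filter_upwards [eventually_gt_atTop 0] with k hk
  rw [Function.comp_apply, ← Real.rpow_mul (norm_nonneg _)]
  congr 1
  push_cast
  field_simp

theorem HasGrowthRate.pi {ι : Type*} [Fintype ι] [Nonempty ι] {a : ι → ℕ → E} {l : ι → ℝ}
    (ha : ∀ i, HasGrowthRate (a i) (l i)) :
    HasGrowthRate (fun k i => a i k) (Finset.univ.sup' Finset.univ_nonempty l) := by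
  refine (Tendsto.finset_sup'_nhds_apply Finset.univ_nonempty fun i _ => ha i).congr fun k => ?_
  refine le_antisymm (Finset.sup'_le _ _ fun i _ => ?_) ?_
  · exact Real.rpow_le_rpow (norm_nonneg _) (norm_le_pi_norm (fun i => a i k) i) (by positivity)
  · obtain ⟨i, hi⟩ := Finite.exists_max fun i => ‖a i k‖
    refine le_trans ?_ (Finset.le_sup' (fun i => ‖a i k‖ ^ (1 / (k : ℝ))) (Finset.mem_univ i))
    exact Real.rpow_le_rpow (norm_nonneg _) ((pi_norm_le_iff_of_nonempty _).2 hi) (by positivity)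

end GrowthRate

section LinearOrbit

theorem hasGrowthRate_pow {A : Type*} [NormedRing A] [NormedAlgebra ℂ A] [CompleteSpace A]
    (a : A) : HasGrowthRate (fun k => a ^ k) (spectralRadius ℂ a).toReal := by
  have hfin : spectralRadius ℂ a ≠ ⊤ := by
    refine ne_top_of_le_ne_top ?_ (spectrum.spectralRadius_le_pow_nnnorm_pow_one_div ℂ a 0)
    simp [← ENNReal.coe_mul]
  refine ((ENNReal.tendsto_toReal hfin).comp
    (spectrum.pow_norm_pow_one_div_tendsto_nhds_spectralRadius a)).congr fun k => ?_
  exact ENNReal.toReal_ofReal (by positivity)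

theorem pow_isBigO_pow_apply_of_span_eq_top {𝕜 V : Type*} [NontriviallyNormedField 𝕜]
    [CompleteSpace 𝕜] [NormedAddCommGroup V] [NormedSpace 𝕜 V] [FiniteDimensional 𝕜 V]
    (g : V →L[𝕜] V) (v : V) (hv : Submodule.span 𝕜 (Set.range fun k : ℕ => (g ^ k) v) = ⊤) :
    (fun k : ℕ => g ^ k) =O[atTop] fun k => (g ^ k) v := by
  let S : Submodule 𝕜 (V →L[𝕜] V) := (Subalgebra.centralizer 𝕜 {g}).toSubmodule
  let eval : S →ₗ[𝕜] V := (ContinuousLinearMap.apply 𝕜 V v).toLinearMap ∘ₗ S.subtype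
  -- An operator that commutes with `g` is determined by its value at the cyclic vector `v`.
  have eval_injective : eval.ker = ⊥ := by
    rw [LinearMap.ker_eq_bot']
    rintro ⟨h, hS⟩ (hhv : h v = 0)
    have hcomm : Commute h g := (Subalgebra.mem_centralizer_iff 𝕜).1 hS g rfl |>.symm
    have hker : ⊤ ≤ (h : V →ₗ[𝕜] V).ker := by
      rw [← hv, Submodule.span_le]
      rintro _ ⟨k, rfl⟩
      have := DFunLike.congr_fun (hcomm.pow_right k).eq v
      simpa [hhv] using this
    exact Subtype.ext (ContinuousLinearMap.ext fun x => hker Submodule.mem_top)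
  obtain ⟨C, -, hC⟩ := eval.exists_antilipschitzWith eval_injective
  refine Asymptotics.IsBigO.of_bound C (Eventually.of_forall fun k => ?_)
  have hpow : g ^ k ∈ S :=
    pow_mem ((Subalgebra.mem_centralizer_iff 𝕜).2 (by simp)) k
  exact hC.le_mul_norm (map_zero eval) ⟨g ^ k, hpow⟩

theorem exists_hasGrowthRate_pow_apply {E : Type*} [NormedAddCommGroup E] [NormedSpace ℂ E]
    [FiniteDimensional ℂ E] (f : Module.End ℂ E) (v : E) :
    ∃ l, HasGrowthRate (fun k => (f ^ k) v) l := by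
  let W : Submodule ℂ E := Submodule.span ℂ (Set.range fun k : ℕ => (f ^ k) v)
  have hW : ∀ x ∈ W, f x ∈ W := by
    change W ≤ W.comap f
    rw [Submodule.span_le]
    rintro _ ⟨k, rfl⟩
    exact Submodule.subset_span ⟨k + 1, by simp [pow_succ']⟩
  let w : W := ⟨v, Submodule.subset_span ⟨0, rfl⟩⟩
  let g : W →L[ℂ] W := Module.End.toContinuousLinearMap W (f.restrict hW)
  have hg : ∀ k : ℕ, ((g ^ k) w : E) = (f ^ k) v := fun k => by
    rw [← map_pow, Module.End.pow_restrict]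
    rfl
  have hspan : Submodule.span ℂ (Set.range fun k : ℕ => (g ^ k) w) = ⊤ := by
    refine Submodule.map_injective_of_injective W.injective_subtype ?_
    rw [Submodule.map_span, ← Set.range_comp, Submodule.map_top, Submodule.range_subtype]
    exact congrArg (fun u => Submodule.span ℂ (Set.range u)) (funext hg)
  have : CompleteSpace W := FiniteDimensional.complete ℂ W
  refine ⟨_, (hasGrowthRate_pow g).of_isTheta ⟨?_, ?_⟩⟩
  · exact Asymptotics.IsBigO.of_bound ‖w‖ <| Eventually.of_forall fun k => by
      rw [← hg, mul_comm]
      exact (g ^ k).le_opNorm w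
  · refine (pow_isBigO_pow_apply_of_span_eq_top g w hspan).trans ?_
    exact Asymptotics.isBigO_of_le _ fun k => by rw [← hg, Submodule.coe_norm]

theorem exists_hasGrowthRate_pow_mul {A : Type*} [NormedRing A] [NormedAlgebra ℂ A]
    [FiniteDimensional ℂ A] (a b : A) : ∃ l, HasGrowthRate (fun k => a ^ k * b) l := by
  simpa only [LinearMap.pow_mulLeft, LinearMap.mulLeft_apply] using
    exists_hasGrowthRate_pow_apply (LinearMap.mulLeft ℂ a) b

theorem exists_isGreatest_hasGrowthRate_pow_mul {A ι : Type*} [NormedRing A] [NormedAlgebra ℂ A]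
    [FiniteDimensional ℂ A] [Fintype ι] [Nonempty ι] (a : A) (w : ι → A) (hw : ∑ i, w i = 1) :
    ∃ l : ι → ℝ, (∀ i, HasGrowthRate (fun k => a ^ k * w i) (l i)) ∧
      IsGreatest (Set.range l) (spectralRadius ℂ a).toReal := by
  have : CompleteSpace A := FiniteDimensional.complete ℂ A
  choose l hl using fun i => exists_hasGrowthRate_pow_mul a (w i)
  have hsum : ∀ k, a ^ k = ∑ i, a ^ k * w i := fun k => by rw [← Finset.mul_sum, hw, mul_one]
  have hTheta : (fun k => a ^ k) =Θ[atTop] fun k i => a ^ k * w i := by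
    constructor
    · refine Asymptotics.IsBigO.of_bound (Fintype.card ι) (Eventually.of_forall fun k => ?_)
      calc ‖a ^ k‖ = ‖∑ i, a ^ k * w i‖ := congrArg norm (hsum k)
        _ ≤ ∑ i, ‖a ^ k * w i‖ := norm_sum_le _ _
        _ ≤ Fintype.card ι • ‖fun i => a ^ k * w i‖ := Pi.sum_norm_apply_le_norm _
        _ = Fintype.card ι * ‖fun i => a ^ k * w i‖ := nsmul_eq_mul _ _
    · refine Asymptotics.isBigO_pi.2 fun i =>
        Asymptotics.IsBigO.of_bound ‖w i‖ (Eventually.of_forall fun k => ?_)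
      rw [mul_comm]
      exact norm_mul_le _ _
  have hrad : (spectralRadius ℂ a).toReal = Finset.univ.sup' Finset.univ_nonempty l :=
    (hasGrowthRate_pow a).unique ((HasGrowthRate.pi hl).of_isTheta hTheta)
  refine ⟨l, hl, ?_⟩
  rw [hrad]
  obtain ⟨i, -, hi⟩ := Finset.exists_mem_eq_sup' Finset.univ_nonempty l
  exact ⟨⟨i, hi.symm⟩, Set.forall_mem_range.2 fun j => Finset.le_sup' l (Finset.mem_univ j)⟩

end LinearOrbit

section FiniteDimensional

variable {V : Type*}

theorem exists_seminorm_le_mul_norm [NormedAddCommGroup V] [NormedSpace ℝ V]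
    [FiniteDimensional ℝ V] (μ : Seminorm ℝ V) : ∃ C, 0 < C ∧ ∀ x, μ x ≤ C * ‖x‖ :=
  μ.bound_of_continuous_normedSpace
    (ConvexOn.locallyLipschitz μ.convexOn).continuous

theorem exists_seminorm_le_mul_of_definite [AddCommGroup V] [Module ℝ V] [FiniteDimensional ℝ V]
    (μ ν : Seminorm ℝ V) (hν : ∀ x, ν x = 0 → x = 0) : ∃ C, ∀ x, μ x ≤ C * ν x := by
  let _ : NormedAddCommGroup V := AddGroupNorm.toNormedAddCommGroup
    { ν with eq_zero_of_map_eq_zero' := hν }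
  let _ : NormedSpace ℝ V := ⟨fun a b => (map_smul_eq_mul ν a b).le⟩
  exact (exists_seminorm_le_mul_norm μ).imp fun _ => And.right

theorem exists_seminorm_le_mul_of_pos_on_cone [NormedAddCommGroup V] [NormedSpace ℝ V]
    [FiniteDimensional ℝ V] {S : Set V} (hS : IsClosed S)
    (hsmul : ∀ c : ℝ, 0 ≤ c → ∀ x ∈ S, c • x ∈ S) (φ : Module.Dual ℝ V)
    (hφ : ∀ x ∈ S, x ≠ 0 → 0 < φ x) (μ : Seminorm ℝ V) : ∃ C, ∀ x ∈ S, μ x ≤ C * φ x := by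
  obtain ⟨D, hD, hμ⟩ := exists_seminorm_le_mul_norm μ
  have hproper : ProperSpace V := FiniteDimensional.proper ℝ V
  have hcompact : IsCompact (S ∩ Metric.sphere 0 1) := (isCompact_sphere _ _).inter_left hS
  obtain ⟨c, hc, hmin⟩ := hcompact.exists_forall_le'
    (LinearMap.continuous_of_finiteDimensional φ).continuousOn
    fun x hx => hφ x hx.1 (Metric.ne_of_mem_sphere hx.2 one_ne_zero)
  have hnorm : ∀ x ∈ S, ‖x‖ ≤ c⁻¹ * φ x := by
    intro x hx
    rcases eq_or_ne x 0 with rfl | hx₀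
    · simp
    have hpos : 0 < ‖x‖ := norm_pos_iff.2 hx₀
    have hunit := hmin (‖x‖⁻¹ • x)
      ⟨hsmul _ (by positivity) x hx, by simp [norm_smul, hpos.ne']⟩
    rw [map_smul, smul_eq_mul, le_inv_mul_iff₀ hpos] at hunit
    rwa [le_inv_mul_iff₀ hc, mul_comm]
  refine ⟨D * c⁻¹, fun x hx => (hμ x).trans ?_⟩
  rw [mul_assoc]
  exact mul_le_mul_of_nonneg_left (hnorm x hx) hD.le

end FiniteDimensional

section MatrixSeminorm

open scoped Matrix.Norms.Elementwise

variable {m n : Type*}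

theorem exists_abs_apply_le_mul_seminorm [Finite m] [Finite n] (ν : Seminorm ℝ (Matrix m n ℝ))
    (hν : ∀ X, ν X = 0 → X = 0) : ∃ C, ∀ X i j, |X i j| ≤ C * ν X := by
  have := Fintype.ofFinite m
  have := Fintype.ofFinite n
  obtain ⟨C, hle⟩ := exists_seminorm_le_mul_of_definite (normSeminorm ℝ _) ν hν
  exact ⟨C, fun X i j => (Matrix.norm_entry_le_entrywise_sup_norm X).trans (hle X)⟩

theorem exists_seminorm_le_mul_of_abs_apply_le [Finite m] [Finite n]
    (ν : Seminorm ℝ (Matrix m n ℝ)) : ∃ C, ∀ X r, 0 ≤ r → (∀ i j, |X i j| ≤ r) → ν X ≤ C * r := by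
  have := Fintype.ofFinite m
  have := Fintype.ofFinite n
  obtain ⟨C, hC, hle⟩ := exists_seminorm_le_mul_norm ν
  refine ⟨C, fun X r hr hX => (hle X).trans ?_⟩
  exact mul_le_mul_of_nonneg_left ((Matrix.norm_le_iff hr).2 hX) hC.le

theorem exists_seminorm_le_mul_seminorm_mul [Finite m] [Fintype n] [DecidableEq n]
    (ν : Seminorm ℝ (Matrix m n ℝ)) (hν : ∀ X, ν X = 0 → X = 0) {A : Matrix n n ℝ}
    (hA : IsUnit A) : ∃ C, ∀ X, ν X ≤ C * ν (X * A) := by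
  refine exists_seminorm_le_mul_of_definite ν (ν.comp (mulRightLinearMap m ℝ A))
    fun X hX => ?_
  obtain ⟨B, hAB⟩ := hA.exists_right_inv
  calc X = X * A * B := by rw [Matrix.mul_assoc, hAB, Matrix.mul_one]
    _ = 0 := by rw [hν (X * A) hX, Matrix.zero_mul]

theorem dual_apply_eq_sum [Fintype m] [Fintype n] [DecidableEq m] [DecidableEq n]
    (φ : Module.Dual ℝ (Matrix m n ℝ)) (X : Matrix m n ℝ) :
    φ X = ∑ i, ∑ j, φ (Matrix.single i j 1) * X i j := by
  conv_lhs => rw [Matrix.matrix_eq_sum_single X]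
  simp only [map_sum]
  refine Finset.sum_congr rfl fun i _ => Finset.sum_congr rfl fun j _ => ?_
  rw [mul_comm, ← smul_eq_mul, ← map_smul, Matrix.smul_single, smul_eq_mul, mul_one]

end MatrixSeminorm

section ProperCone

variable {d : ℕ} {K : Set (Fin d → ℝ)}

theorem IsProperCone.zero_mem (hK : IsProperCone K) : 0 ∈ K := by
  obtain ⟨x, hx⟩ := hK.solid
  simpa using hK.smul_mem 0 le_rfl x (interior_subset hx)

theorem IsProperCone.exists_dual_neg_of_notMem (hK : IsProperCone K) {x : Fin d → ℝ}
    (hx : x ∉ K) : ∃ φ : Module.Dual ℝ (Fin d → ℝ), (∀ y ∈ K, 0 ≤ φ y) ∧ φ x < 0 := by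
  obtain ⟨f, u, hfx, hf⟩ := geometric_hahn_banach_point_closed hK.convex hK.isClosed hx
  have hu : u < 0 := by simpa using hf 0 hK.zero_mem
  refine ⟨f, fun y hy => ?_, hfx.trans hu⟩
  by_contra! hneg : f y < 0
  have hscaled := hf _ (hK.smul_mem (u / f y) (div_nonneg_of_nonpos hu.le hneg.le) y hy)
  rw [map_smul, smul_eq_mul, div_mul_cancel₀ _ hneg.ne] at hscaled
  exact hscaled.false

theorem IsProperCone.exists_dual_pos (hK : IsProperCone K) :
    ∃ φ : Module.Dual ℝ (Fin d → ℝ), ∀ x ∈ K, x ≠ 0 → 0 < φ x := by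
  -- The sum of a finite spanning subset of the dual cone vanishes on `K` only where the whole dual
  -- cone does, that is, on `K ∩ -K`.
  let dualCone : Set (Module.Dual ℝ (Fin d → ℝ)) := {φ | ∀ x ∈ K, 0 ≤ φ x}
  obtain ⟨t, ht, hspan⟩ := (Submodule.fg_span_iff_fg_span_finset_subset dualCone).1
    (IsNoetherian.noetherian (Submodule.span ℝ dualCone))
  refine ⟨∑ φ ∈ t, φ, fun x hx hx₀ => ?_⟩
  rw [LinearMap.sum_apply]
  refine (Finset.sum_nonneg fun φ hφ => ht hφ x hx).lt_of_ne' fun hsum => hx₀ ?_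
  have hzero : ∀ φ ∈ t, φ x = 0 := (Finset.sum_eq_zero_iff_of_nonneg fun φ hφ => ht hφ x hx).1 hsum
  have hann : dualCone ⊆ (Module.Dual.eval ℝ _ x).ker := by
    refine Submodule.subset_span.trans (SetLike.coe_subset_coe.2 ?_)
    rw [hspan, Submodule.span_le]
    exact hzero
  refine hK.pointed x hx (by_contra fun hneg => ?_)
  obtain ⟨φ, hφ, hlt⟩ := hK.exists_dual_neg_of_notMem hneg
  rw [map_neg, show φ x = 0 from hann hφ, neg_zero] at hlt
  exact hlt.false

theorem IsProperCone.eq_zero_of_mulVec_eq_zero (hK : IsProperCone K)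
    {X : Matrix (Fin d) (Fin d) ℝ} (hX : LeavesInvariant X K) {v : Fin d → ℝ}
    (hv : v ∈ interior K) (hXv : X.mulVec v = 0) : X = 0 := by
  have hline : ∀ y : Fin d → ℝ, ∀ᶠ ε : ℝ in 𝓝[>] 0, v + ε • y ∈ K := fun y => by
    have hcont : Tendsto (fun ε : ℝ => v + ε • y) (𝓝 0) (𝓝 v) :=
      Continuous.tendsto' (by fun_prop) _ _ (by simp)
    exact (hcont.eventually (mem_interior_iff_mem_nhds.1 hv)).filter_mono nhdsWithin_le_nhds
  refine Matrix.ext_of_mulVec_single fun i => ?_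
  rw [Matrix.zero_mulVec]
  set y : Fin d → ℝ := Pi.single i 1
  obtain ⟨ε, hadd, hsub, hε : 0 < ε⟩ :=
    ((hline y).and ((hline (-y)).and self_mem_nhdsWithin)).exists
  have hy : ε • X.mulVec y = 0 := by
    refine hK.pointed _ ?_ ?_
    · simpa [Matrix.mulVec_add, Matrix.mulVec_smul, hXv] using hX _ hadd
    · simpa [Matrix.mulVec_add, Matrix.mulVec_smul, Matrix.mulVec_neg, hXv] using hX _ hsub
  exact (smul_eq_zero.1 hy).resolve_left hε.ne'

open scoped Matrix.Norms.Elementwise in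
theorem IsProperCone.exists_seminorm_le_dual (hK : IsProperCone K)
    (ν : Seminorm ℝ (Matrix (Fin d) (Fin d) ℝ)) :
    ∃ φ : Module.Dual ℝ (Matrix (Fin d) (Fin d) ℝ), ∀ X, LeavesInvariant X K → ν X ≤ φ X := by
  obtain ⟨φ, hφ⟩ := hK.exists_dual_pos
  obtain ⟨v, hv⟩ := hK.solid
  have hclosed : IsClosed {X : Matrix (Fin d) (Fin d) ℝ | LeavesInvariant X K} := by
    simp only [LeavesInvariant, Set.ofPred_forall]
    exact isClosed_biInter fun x _ => hK.isClosed.preimage (by fun_prop)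
  obtain ⟨C, hC⟩ := exists_seminorm_le_mul_of_pos_on_cone hclosed
    (fun c hc X hX x hx => by simpa [Matrix.smul_mulVec] using hK.smul_mem c hc _ (hX x hx))
    (φ ∘ₗ (Matrix.mulVecBilin ℝ ℝ).flip v)
    (fun X hX hX₀ => hφ _ (hX v (interior_subset hv)) fun hXv =>
      hX₀ (hK.eq_zero_of_mulVec_eq_zero hX hv hXv)) ν
  exact ⟨C • (φ ∘ₗ (Matrix.mulVecBilin ℝ ℝ).flip v), fun X hX => hC X hX⟩

end ProperCone

section KroneckerPower

variable {d : ℕ}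

theorem kronPow_mul (A B : Matrix (Fin d) (Fin d) ℝ) (p : ℕ) :
    kronPow (A * B) p = kronPow A p * kronPow B p := by
  ext a b
  simp only [kronPow, Matrix.of_apply, Matrix.mul_apply, Finset.prod_univ_sum,
    Fintype.piFinset_univ, Finset.prod_mul_distrib]

theorem kronPow_one (p : ℕ) : kronPow (1 : Matrix (Fin d) (Fin d) ℝ) p = 1 := by
  ext a b
  simp only [kronPow, Matrix.of_apply, Matrix.one_apply, Finset.prod_ite_zero,
    Finset.mem_univ, forall_const, Finset.prod_const_one, funext_iff]

theorem kronPow_const_apply (X : Matrix (Fin d) (Fin d) ℝ) (p : ℕ) (i j : Fin d) :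
    kronPow X p (fun _ => i) (fun _ => j) = X i j ^ p := by
  simp only [kronPow, Matrix.of_apply, Finset.prod_const, Finset.card_univ, Fintype.card_fin]

theorem abs_kronPow_apply_le {X : Matrix (Fin d) (Fin d) ℝ} {r : ℝ} (hX : ∀ i j, |X i j| ≤ r)
    (p : ℕ) (a b : Fin p → Fin d) : |kronPow X p a b| ≤ r ^ p := by
  rw [kronPow, Matrix.of_apply, Finset.abs_prod]
  exact (Finset.prod_le_prod (fun _ _ => abs_nonneg _) fun l _ => hX (a l) (b l)).trans_eq (by simp)

theorem exists_dual_kronPow_eq_pow (φ : Module.Dual ℝ (Matrix (Fin d) (Fin d) ℝ)) (p : ℕ) :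
    ∃ Φ : Module.Dual ℝ (Matrix (Fin p → Fin d) (Fin p → Fin d) ℝ),
      ∀ X, Φ (kronPow X p) = φ X ^ p := by
  let c : Matrix (Fin d) (Fin d) ℝ := Matrix.of fun i j => φ (Matrix.single i j 1)
  refine ⟨∑ a, ∑ b, kronPow c p a b • Matrix.entryLinearMap ℝ ℝ a b, fun X => ?_⟩
  have hφ : φ X = ∑ q : Fin d × Fin d, c q.1 q.2 * X q.1 q.2 := by
    rw [dual_apply_eq_sum φ X, Fintype.sum_prod_type]
    rfl
  rw [hφ, Fintype.sum_pow,
    ← (Equiv.arrowProdEquivProdArrow (Fin p) (fun _ => Fin d) fun _ => Fin d).symm.sum_comp,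
    Fintype.sum_prod_type]
  simp [kronPow, Finset.prod_mul_distrib, LinearMap.sum_apply]

theorem exists_seminorm_pow_le_dual_kronPow_of_even {p : ℕ} (hp : Even p) (hp₀ : p ≠ 0)
    (ν : Seminorm ℝ (Matrix (Fin d) (Fin d) ℝ)) :
    ∃ Φ : Module.Dual ℝ (Matrix (Fin p → Fin d) (Fin p → Fin d) ℝ),
      ∀ X, ν X ^ p ≤ Φ (kronPow X p) := by
  obtain ⟨C, hν⟩ := exists_seminorm_le_mul_of_abs_apply_le ν
  refine ⟨C ^ p • ∑ i, ∑ j, Matrix.entryLinearMap ℝ ℝ (fun _ => i) fun _ => j, fun X => ?_⟩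
  set s : ℝ := ∑ i, ∑ j, X i j ^ p
  have hs : 0 ≤ s := Finset.sum_nonneg fun i _ => Finset.sum_nonneg fun j _ => hp.pow_nonneg _
  have hentry : ∀ i j, |X i j| ≤ s ^ (p : ℝ)⁻¹ := fun i j => by
    refine le_of_pow_le_pow_left₀ hp₀ (by positivity) ?_
    rw [hp.pow_abs, Real.rpow_inv_natCast_pow hs hp₀]
    calc X i j ^ p ≤ ∑ j, X i j ^ p :=
          Finset.single_le_sum (fun j _ => hp.pow_nonneg (X i j)) (Finset.mem_univ j)
      _ ≤ s := Finset.single_le_sum (f := fun i => ∑ j, X i j ^ p)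
          (fun i _ => Finset.sum_nonneg fun j _ => hp.pow_nonneg _) (Finset.mem_univ i)
  calc ν X ^ p ≤ (C * s ^ (p : ℝ)⁻¹) ^ p :=
        pow_le_pow_left₀ (apply_nonneg ν X) (hν X _ (by positivity) hentry) p
    _ = C ^ p * s := by rw [mul_pow, Real.rpow_inv_natCast_pow hs hp₀]
    _ = _ := by simp [LinearMap.sum_apply, kronPow_const_apply, s]

/-- The monoid of matrices that leave `K` invariant; in the cone case every product of the `M_i`
belongs to it. -/
def invariantSubmonoid (K : Set (Fin d → ℝ)) : Submonoid (Matrix (Fin d) (Fin d) ℝ) where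
  carrier := {X | LeavesInvariant X K}
  one_mem' x hx := by rwa [Matrix.one_mulVec]
  mul_mem' {X Y} hX hY x hx := by
    rw [← Matrix.mulVec_mulVec]
    exact hX _ (hY x hx)

theorem exists_submonoid_seminorm_pow_le_dual_kronPow {ι : Type*}
    {M : ι → Matrix (Fin d) (Fin d) ℝ} {p : ℕ} (hp₀ : p ≠ 0)
    (hp : Even p ∨ ∃ K, IsProperCone K ∧ ∀ i, LeavesInvariant (M i) K)
    (ν : Seminorm ℝ (Matrix (Fin d) (Fin d) ℝ)) :
    ∃ S : Submonoid (Matrix (Fin d) (Fin d) ℝ), (∀ i, M i ∈ S) ∧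
      ∃ Φ : Module.Dual ℝ (Matrix (Fin p → Fin d) (Fin p → Fin d) ℝ),
        ∀ X ∈ S, ν X ^ p ≤ Φ (kronPow X p) := by
  rcases hp with heven | ⟨K, hK, hM⟩
  · obtain ⟨Φ, hΦ⟩ := exists_seminorm_pow_le_dual_kronPow_of_even heven hp₀ ν
    exact ⟨⊤, fun i => Submonoid.mem_top _, Φ, fun X _ => hΦ X⟩
  · obtain ⟨φ, hφ⟩ := hK.exists_seminorm_le_dual ν
    obtain ⟨Φ, hΦ⟩ := exists_dual_kronPow_eq_pow φ p
    refine ⟨invariantSubmonoid K, hM, Φ, fun X hX => ?_⟩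
    rw [hΦ]
    exact pow_le_pow_left₀ (apply_nonneg ν X) (hφ X hX) p

end KroneckerPower

section MatrixOrbit

open scoped Matrix.Norms.Frobenius

theorem isBigO_matrix_iff {α m n F : Type*} [Fintype m] [Fintype n] [SeminormedAddCommGroup F]
    {l : Filter α} {f : α → Matrix m n ℝ} {g : α → F} :
    f =O[l] g ↔ ∀ i j, (fun x => f x i j) =O[l] g := by
  constructor
  · intro h i j
    let entry : Matrix m n ℝ →L[ℝ] ℝ :=
      LinearMap.toContinuousLinearMap (Matrix.entryLinearMap ℝ ℝ i j)
    exact (entry.isBigO_comp f l).trans h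
  · intro h
    let ofPi : (m → n → ℝ) →L[ℝ] Matrix m n ℝ :=
      LinearMap.toContinuousLinearMap (Matrix.ofLinearEquiv ℝ).toLinearMap
    refine (ofPi.isBigO_comp (fun x i j => f x i j) l).trans ?_
    exact Asymptotics.isBigO_pi.2 fun i => Asymptotics.isBigO_pi.2 fun j => h i j

theorem exists_isGreatest_hasGrowthRate_matrix_pow_mul {n ι : Type*} [Fintype n] [DecidableEq n]
    [Fintype ι] [Nonempty ι] (T : Matrix n n ℝ) (w : ι → Matrix n n ℝ) (hw : ∑ i, w i = 1) :
    ∃ l : ι → ℝ, (∀ i, HasGrowthRate (fun k => T ^ k * w i) (l i)) ∧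
      IsGreatest (Set.range l) (specRadius T) := by
  let toComplex : Matrix n n ℝ →+* Matrix n n ℂ := (algebraMap ℝ ℂ).mapMatrix
  have norm_toComplex : ∀ X, ‖toComplex X‖ = ‖X‖ := fun X =>
    Matrix.frobenius_norm_map_eq X _ (norm_algebraMap' ℂ)
  obtain ⟨l, hl, hmax⟩ := exists_isGreatest_hasGrowthRate_pow_mul (toComplex T)
    (fun i => toComplex (w i)) (by rw [← map_sum, hw, map_one])
  refine ⟨l, fun i => ?_, hmax⟩
  simpa only [HasGrowthRate, ← map_pow, ← map_mul, norm_toComplex] using hl i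

end MatrixOrbit

section TransferMatrix

theorem spectralRadius_mul_comm {𝕜 A : Type*} [NormedField 𝕜] [Ring A] [Algebra 𝕜 A] (a b : A) :
    spectralRadius 𝕜 (a * b) = spectralRadius 𝕜 (b * a) := by
  have hle : ∀ a b : A, spectralRadius 𝕜 (a * b) ≤ spectralRadius 𝕜 (b * a) := by
    refine fun a b => iSup₂_le fun z hz => ?_
    rcases eq_or_ne z 0 with rfl | hz₀
    · simp
    · have hz' : z ∈ spectrum 𝕜 (b * a) \ {0} :=
        spectrum.nonzero_mul_comm (𝕜 := 𝕜) a b ▸ ⟨hz, hz₀⟩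
      exact le_iSup₂_of_le z hz'.1 le_rfl
  exact le_antisymm (hle a b) (hle b a)

variable {N d : ℕ} (P : Matrix (Fin N) (Fin N) ℝ) (M : Fin N → Matrix (Fin d) (Fin d) ℝ) (p : ℕ)

/-- The matrix `diag(M_1^{⊗p}, …, M_N^{⊗p}) (Pᵀ ⊗ I)`, with the two factors of `T_p` exchanged:
its `k`-th power involves the states `σ_1, …, σ_k`, as the product `A_k ⋯ A_1` does, whereas
`T_p ^ k` involves `σ_0, …, σ_{k-1}`. -/
def swappedTransferMatrix : Matrix (Fin N × (Fin p → Fin d)) (Fin N × (Fin p → Fin d)) ℝ :=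
  (Matrix.blockDiagonal fun i => kronPow (M i) p).submatrix Prod.swap Prod.swap *
    (P.transpose ⊗ₖ (1 : Matrix (Fin p → Fin d) (Fin p → Fin d) ℝ))

theorem swappedTransferMatrix_apply (j i : Fin N) (a b : Fin p → Fin d) :
    swappedTransferMatrix P M p (j, a) (i, b) = P i j * kronPow (M j) p a b := by
  simp [swappedTransferMatrix, Matrix.mul_apply, Fintype.sum_prod_type,
    Matrix.blockDiagonal_apply, Matrix.one_apply, mul_comm]

theorem specRadius_swappedTransferMatrix :
    specRadius (swappedTransferMatrix P M p) = specRadius (transferMatrix P M p) := by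
  simp only [specRadius, swappedTransferMatrix, transferMatrix, Matrix.map_mul]
  rw [spectralRadius_mul_comm]

end TransferMatrix

section TransitionOperator

variable {ι G : Type*} [Fintype ι] {P : Matrix ι ι ℝ}

/-- The transition operator of the Markov chain `(A_k ⋯ A_1, σ_k)` on functions of its state. -/
def transitionOp [Mul G] (P : Matrix ι ι ℝ) (M : ι → G) : Module.End ℝ (G → ι → ℝ) where
  toFun g X i := ∑ j, P i j * g (M j * X) j
  map_add' f g := by
    ext X i
    simp only [Pi.add_apply, mul_add, Finset.sum_add_distrib]
  map_smul' c g := by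
    ext X i
    simp only [Pi.smul_apply, smul_eq_mul, RingHom.id_apply, Finset.mul_sum, mul_left_comm]

theorem transitionOp_apply [Mul G] (P : Matrix ι ι ℝ) (M : ι → G) (g : G → ι → ℝ) (X : G) (i : ι) :
    transitionOp P M g X i = ∑ j, P i j * g (M j * X) j :=
  rfl

theorem transitionOp_pow_mono_on [Mul G] {M : ι → G} (hP : ∀ i j, 0 ≤ P i j) {S : Set G}
    (hS : ∀ j, Set.MapsTo (M j * ·) S S) {f g : G → ι → ℝ} (hfg : ∀ X ∈ S, ∀ i, f X i ≤ g X i)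
    (k : ℕ) : ∀ X ∈ S, ∀ i, (transitionOp P M ^ k) f X i ≤ (transitionOp P M ^ k) g X i := by
  induction k with
  | zero => exact hfg
  | succ k ih =>
    intro X hX i
    simp only [pow_succ', Module.End.mul_apply, transitionOp_apply]
    exact Finset.sum_le_sum fun j _ => mul_le_mul_of_nonneg_left (ih _ (hS j hX) j) (hP i j)

theorem transitionOp_pow_mono [Mul G] {M : ι → G} (hP : ∀ i j, 0 ≤ P i j) {f g : G → ι → ℝ}
    (hfg : f ≤ g) (k : ℕ) : (transitionOp P M ^ k) f ≤ (transitionOp P M ^ k) g := fun X =>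
  transitionOp_pow_mono_on hP (fun _ => Set.mapsTo_univ _ _) (fun X _ => hfg X) k X (Set.mem_univ X)

theorem transitionOp_pow_nonneg [Mul G] {M : ι → G} (hP : ∀ i j, 0 ≤ P i j) {g : G → ι → ℝ}
    (hg : 0 ≤ g) (k : ℕ) : 0 ≤ (transitionOp P M ^ k) g := by
  simpa only [map_zero] using transitionOp_pow_mono (M := M) hP hg k

theorem abs_transitionOp_pow_le [Mul G] {M : ι → G} (hP : ∀ i j, 0 ≤ P i j) {f g : G → ι → ℝ}
    (hfg : |f| ≤ g) (k : ℕ) : |(transitionOp P M ^ k) f| ≤ (transitionOp P M ^ k) g := by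
  obtain ⟨hneg, hpos⟩ := abs_le'.1 hfg |>.symm
  refine abs_le'.2 ⟨transitionOp_pow_mono hP hpos k, ?_⟩
  rw [← map_neg]
  exact transitionOp_pow_mono hP hneg k

theorem transitionOp_pow_mul_right [Semigroup G] (M : ι → G) (g : G → ι → ℝ) (Y : G) (k : ℕ) :
    ∀ X i, (transitionOp P M ^ k) (fun X => g (X * Y)) X i =
      (transitionOp P M ^ k) g (X * Y) i := by
  induction k with
  | zero => exact fun X i => rfl
  | succ k ih =>
    intro X i
    simp only [pow_succ', Module.End.mul_apply, transitionOp_apply, ih, mul_assoc]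

/-- The expectation of `g (A_k ⋯ A_1) σ_k`, where `A_n = M σ_n` and `σ` is a Markov chain with
transition matrix `P` started at `s`. -/
def pathExpectation [Monoid G] (P : Matrix ι ι ℝ) (M : ι → G) (g : G → ι → ℝ) (k : ℕ) (s : ι) : ℝ :=
  (transitionOp P M ^ k) g 1 s

theorem swappedTransferMatrix_pow_apply {N d : ℕ} (P : Matrix (Fin N) (Fin N) ℝ)
    (M : Fin N → Matrix (Fin d) (Fin d) ℝ) (p k : ℕ) (j s : Fin N) (a b : Fin p → Fin d) :
    (swappedTransferMatrix P M p ^ k) (j, a) (s, b) =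
      pathExpectation P M (fun X i => if i = j then kronPow X p a b else 0) k s := by
  set T := swappedTransferMatrix P M p with hT
  let g : Fin N × (Fin p → Fin d) → Matrix (Fin d) (Fin d) ℝ → Fin N → ℝ :=
    fun x X i => if i = x.1 then kronPow X p x.2 b else 0
  have transitionOp_g : ∀ x, transitionOp P M (g x) = ∑ y, T x y • g y := by
    rintro ⟨j, a⟩
    ext X i
    simp [transitionOp_apply, g, hT, swappedTransferMatrix_apply, Fintype.sum_prod_type,
      kronPow_mul, Matrix.mul_apply, Finset.mul_sum, mul_assoc]
  suffices ∀ x, (T ^ k) x (s, b) = (transitionOp P M ^ k) (g x) 1 s from this (j, a)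
  induction k with
  | zero =>
    rintro ⟨j, a⟩
    simp [g, kronPow_one, Matrix.one_apply, eq_comm, ite_and]
  | succ k ih =>
    intro x
    rw [pow_succ', Matrix.mul_apply, pow_succ, Module.End.mul_apply, transitionOp_g]
    simp only [ih, map_sum, map_smul, Finset.sum_apply, Pi.smul_apply, smul_eq_mul]

end TransitionOperator

section MarkovChain

theorem integral_comp_fintype {Ω H E : Type*} [MeasurableSpace Ω] (μ : Measure Ω)
    [IsFiniteMeasure μ] [Fintype H] [MeasurableSpace H] [MeasurableSingletonClass H]
    [NormedAddCommGroup E] [NormedSpace ℝ E] [CompleteSpace E] {Y : Ω → H}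
    (hY : Measurable Y) (f : H → E) :
    ∫ ω, f (Y ω) ∂μ = ∑ y, μ.real (Y ⁻¹' {y}) • f y := by
  rw [← integral_map hY.aemeasurable StronglyMeasurable.of_discrete.aestronglyMeasurable,
    integral_fintype Integrable.of_finite]
  simp only [map_measureReal_apply hY (measurableSet_singleton _)]

variable {N d : ℕ} {Ω : Type*}

/-- The trajectory `(σ_0, …, σ_k)`. -/
def history (σ : ℕ → Ω → Fin N) (k : ℕ) (ω : Ω) : Fin (k + 1) → Fin N := fun n => σ n ω

theorem exists_revProd_eq_comp_history (M : Fin N → Matrix (Fin d) (Fin d) ℝ) (σ : ℕ → Ω → Fin N)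
    (k : ℕ) : ∃ G : (Fin (k + 1) → Fin N) → Matrix (Fin d) (Fin d) ℝ,
      ∀ ω, revProd (fun n ω => M (σ n ω)) k ω = G (history σ k ω) := by
  induction k with
  | zero => exact ⟨fun _ => 1, fun _ => rfl⟩
  | succ k ih =>
    obtain ⟨G, hG⟩ := ih
    exact ⟨fun h => M (h (Fin.last _)) * G (Fin.init h), fun ω => by rw [revProd, hG]; rfl⟩

variable {P : Matrix (Fin N) (Fin N) ℝ} {s₀ : Fin N} [MeasurableSpace Ω] {μ : Measure Ω}
  {σ : ℕ → Ω → Fin N}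

theorem IsMarkovChain.measurable_history (hσ : IsMarkovChain P s₀ μ σ) (k : ℕ) :
    Measurable (history σ k) :=
  measurable_pi_lambda _ fun n => hσ.measurable n

theorem IsMarkovChain.measureReal_history_succ (hσ : IsMarkovChain P s₀ μ σ) (k : ℕ)
    (h : Fin (k + 1) → Fin N) (j : Fin N) :
    μ.real ((fun ω => (history σ k ω, σ (k + 1) ω)) ⁻¹' {(h, j)}) =
      μ.real (history σ k ⁻¹' {h}) * P (h (Fin.last k)) j := by
  let path : ℕ → Fin N := fun n => if hn : n < k + 1 then h ⟨n, hn⟩ else j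
  have path_k : path k = h (Fin.last k) := dif_pos k.lt_succ_self
  have path_succ : path (k + 1) = j := dif_neg (lt_irrefl _)
  have history_eq_iff : ∀ ω, (∀ n ≤ k, σ n ω = path n) ↔ history σ k ω = h := fun ω => by
    simp only [funext_iff, Fin.forall_iff, ← Nat.lt_succ_iff]
    exact forall₂_congr fun n hn => by rw [history, show path n = h ⟨n, hn⟩ from dif_pos hn]
  have htrans := hσ.transition k path
  simp only [Nat.le_succ_iff, or_imp, forall_and, forall_eq, history_eq_iff] at htrans
  rw [path_k, path_succ] at htrans
  simpa only [Set.preimage, Set.mem_singleton_iff, Prod.mk.injEq] using htrans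

theorem IsMarkovChain.integral_succ [IsProbabilityMeasure μ] (hσ : IsMarkovChain P s₀ μ σ) (k : ℕ)
    (F : (Fin (k + 1) → Fin N) → Fin N → ℝ) :
    ∫ ω, F (history σ k ω) (σ (k + 1) ω) ∂μ =
      ∫ ω, ∑ j, P (σ k ω) j * F (history σ k ω) j ∂μ := by
  have integral_pair := integral_comp_fintype μ
    ((hσ.measurable_history k).prodMk (hσ.measurable (k + 1))) fun y => F y.1 y.2
  have integral_history := integral_comp_fintype μ (hσ.measurable_history k)
    fun h => ∑ j, P (h (Fin.last k)) j * F h j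
  refine integral_pair.trans (Eq.trans ?_ integral_history.symm)
  simp only [Fintype.sum_prod_type, hσ.measureReal_history_succ, smul_eq_mul, Finset.mul_sum,
    mul_assoc]

theorem IsMarkovChain.integral_revProd [IsProbabilityMeasure μ] (hσ : IsMarkovChain P s₀ μ σ)
    (M : Fin N → Matrix (Fin d) (Fin d) ℝ) (g : Matrix (Fin d) (Fin d) ℝ → Fin N → ℝ) (k : ℕ) :
    ∫ ω, g (revProd (fun n ω => M (σ n ω)) k ω) (σ k ω) ∂μ = pathExpectation P M g k s₀ := by
  induction k generalizing g with
  | zero =>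
    have hinit : ∀ᵐ ω ∂μ, g (revProd (fun n ω => M (σ n ω)) 0 ω) (σ 0 ω) = g 1 s₀ :=
      hσ.initial.mono fun ω hω => by rw [hω, revProd]
    rw [integral_congr_ae hinit, integral_const, probReal_univ, one_smul]
    rfl
  | succ k ih =>
    obtain ⟨G, hG⟩ := exists_revProd_eq_comp_history M σ k
    calc ∫ ω, g (revProd (fun n ω => M (σ n ω)) (k + 1) ω) (σ (k + 1) ω) ∂μ
        = ∫ ω, ∑ j, P (σ k ω) j * g (M j * G (history σ k ω)) j ∂μ := by
          simp only [revProd, hG]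
          exact hσ.integral_succ k fun h j => g (M j * G h) j
      _ = pathExpectation P M (transitionOp P M g) k s₀ := by
          rw [← ih]
          simp only [hG, transitionOp_apply]
      _ = pathExpectation P M g (k + 1) s₀ := by
          rw [pathExpectation, pathExpectation, pow_succ, Module.End.mul_apply]

end MarkovChain

section NormMoments

variable {N d : ℕ} {P : Matrix (Fin N) (Fin N) ℝ} {M : Fin N → Matrix (Fin d) (Fin d) ℝ} {p : ℕ}

/-- The moment `E[ν (A_k ⋯ A_1) ^ p]` of the Markov switched product started at `s`. -/
def normMoment (P : Matrix (Fin N) (Fin N) ℝ) (M : Fin N → Matrix (Fin d) (Fin d) ℝ)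
    (ν : Seminorm ℝ (Matrix (Fin d) (Fin d) ℝ)) (p k : ℕ) (s : Fin N) : ℝ :=
  pathExpectation P M (fun X _ => ν X ^ p) k s

theorem normMoment_nonneg (hP : ∀ i j, 0 ≤ P i j) (ν : Seminorm ℝ (Matrix (Fin d) (Fin d) ℝ))
    (k : ℕ) (s : Fin N) : 0 ≤ normMoment P M ν p k s :=
  transitionOp_pow_nonneg hP (fun X _ => pow_nonneg (apply_nonneg ν X) p) k 1 s

theorem exists_abs_swappedTransferMatrix_pow_le_normMoment (hP : ∀ i j, 0 ≤ P i j)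
    (ν : Seminorm ℝ (Matrix (Fin d) (Fin d) ℝ)) (hν : ∀ X, ν X = 0 → X = 0) :
    ∃ C, ∀ k j s a b,
      |(swappedTransferMatrix P M p ^ k) (j, a) (s, b)| ≤ C * normMoment P M ν p k s := by
  obtain ⟨C, hC⟩ := exists_abs_apply_le_mul_seminorm ν hν
  refine ⟨C ^ p, fun k j s a b => ?_⟩
  let momentFun : Matrix (Fin d) (Fin d) ℝ → Fin N → ℝ := fun X _ => ν X ^ p
  have hentry : |fun (X : Matrix (Fin d) (Fin d) ℝ) i => if i = j then kronPow X p a b else 0| ≤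
      C ^ p • momentFun := by
    intro X i
    have hX : |kronPow X p a b| ≤ C ^ p * ν X ^ p := by
      rw [← mul_pow]
      exact abs_kronPow_apply_le (hC X) p a b
    by_cases hij : i = j
    · simpa [hij] using hX
    · simpa [hij] using (abs_nonneg _).trans hX
  rw [swappedTransferMatrix_pow_apply]
  have h := abs_transitionOp_pow_le (M := M) hP hentry k
  rw [map_smul] at h
  exact h 1 s

theorem normMoment_le_sum_swappedTransferMatrix_pow (hP : ∀ i j, 0 ≤ P i j)
    {ν : Seminorm ℝ (Matrix (Fin d) (Fin d) ℝ)}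
    {S : Submonoid (Matrix (Fin d) (Fin d) ℝ)} (hM : ∀ i, M i ∈ S)
    {Φ : Module.Dual ℝ (Matrix (Fin p → Fin d) (Fin p → Fin d) ℝ)}
    (hΦ : ∀ X ∈ S, ν X ^ p ≤ Φ (kronPow X p)) (k : ℕ) (s : Fin N) :
    normMoment P M ν p k s ≤ ∑ a, ∑ b, Φ (Matrix.single a b 1) *
      ∑ j, (swappedTransferMatrix P M p ^ k) (j, a) (s, b) := by
  let entry (j : Fin N) (a b : Fin p → Fin d) : Matrix (Fin d) (Fin d) ℝ → Fin N → ℝ :=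
    fun X i => if i = j then kronPow X p a b else 0
  have hle : ∀ X ∈ S, ∀ i : Fin N,
      ν X ^ p ≤ (∑ a, ∑ b, Φ (Matrix.single a b 1) • ∑ j, entry j a b) X i := by
    intro X hX i
    simpa [entry, ← dual_apply_eq_sum] using hΦ X hX
  refine (transitionOp_pow_mono_on hP (fun j X hX => S.mul_mem (hM j) hX) hle k 1 S.one_mem
    s).trans_eq ?_
  simp only [swappedTransferMatrix_pow_apply, pathExpectation, map_sum, map_smul,
    Finset.sum_apply, Pi.smul_apply, smul_eq_mul, entry]

open scoped Matrix.Norms.Frobenius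

/-- The coordinate projection onto the block of the state `s`: right multiplication by it selects
the columns that describe the chains started at `s`. -/
def blockProj (N d p : ℕ) (s : Fin N) :
    Matrix (Fin N × (Fin p → Fin d)) (Fin N × (Fin p → Fin d)) ℝ :=
  Matrix.diagonal fun x => if x.1 = s then 1 else 0

theorem sum_blockProj (N d p : ℕ) : ∑ s, blockProj N d p s = 1 := by
  ext x y
  simp [blockProj, Matrix.sum_apply, Matrix.diagonal_apply, Matrix.one_apply]

theorem mul_blockProj_apply (X : Matrix (Fin N × (Fin p → Fin d)) (Fin N × (Fin p → Fin d)) ℝ)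
    (s : Fin N) (x y : Fin N × (Fin p → Fin d)) :
    (X * blockProj N d p s) x y = if y.1 = s then X x y else 0 := by
  simp only [blockProj, Matrix.mul_diagonal, mul_ite, mul_one, mul_zero]

theorem normMoment_isBigO_swappedTransferMatrix_pow (hP : ∀ i j, 0 ≤ P i j)
    {ν : Seminorm ℝ (Matrix (Fin d) (Fin d) ℝ)}
    {S : Submonoid (Matrix (Fin d) (Fin d) ℝ)} (hM : ∀ i, M i ∈ S)
    {Φ : Module.Dual ℝ (Matrix (Fin p → Fin d) (Fin p → Fin d) ℝ)}
    (hΦ : ∀ X ∈ S, ν X ^ p ≤ Φ (kronPow X p)) (s : Fin N) :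
    (fun k => normMoment P M ν p k s) =O[atTop]
      fun k => swappedTransferMatrix P M p ^ k * blockProj N d p s := by
  set T := swappedTransferMatrix P M p
  have hentry : ∀ j a b, (fun k => (T ^ k) (j, a) (s, b)) =O[atTop]
      fun k => T ^ k * blockProj N d p s := fun j a b => by
    have h := isBigO_matrix_iff.1 (Asymptotics.isBigO_refl
      (fun k => T ^ k * blockProj N d p s) atTop) (j, a) (s, b)
    simpa only [mul_blockProj_apply, if_true] using h
  have hbound : (fun k => normMoment P M ν p k s) =O[atTop]
      fun k => ∑ a, ∑ b, Φ (Matrix.single a b 1) * ∑ j, (T ^ k) (j, a) (s, b) :=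
    .of_norm_le fun k => by
      rw [Real.norm_of_nonneg (normMoment_nonneg hP ν k s)]
      exact normMoment_le_sum_swappedTransferMatrix_pow hP hM hΦ k s
  exact hbound.trans <| .fun_sum fun a _ => .fun_sum fun b _ =>
    .const_mul_left (.fun_sum fun j _ => hentry j a b) _

theorem swappedTransferMatrix_pow_isBigO_normMoment (hP : ∀ i j, 0 ≤ P i j)
    {ν : Seminorm ℝ (Matrix (Fin d) (Fin d) ℝ)} (hν : ∀ X, ν X = 0 → X = 0) (s : Fin N) :
    (fun k => swappedTransferMatrix P M p ^ k * blockProj N d p s) =O[atTop]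
      fun k => normMoment P M ν p k s := by
  obtain ⟨C, hC⟩ := exists_abs_swappedTransferMatrix_pow_le_normMoment (M := M) (p := p) hP ν hν
  refine isBigO_matrix_iff.2 fun x y => ?_
  simp only [mul_blockProj_apply]
  split_ifs with hy
  · subst hy
    refine .of_bound C (.of_forall fun k => ?_)
    rw [Real.norm_of_nonneg (normMoment_nonneg hP ν k y.1)]
    exact hC k x.1 y.1 x.2 y.2
  · exact Asymptotics.isBigO_zero _ _

theorem exists_isGreatest_hasGrowthRate_normMoment [NeZero N] (hP : ∀ i j, 0 ≤ P i j)
    {ν : Seminorm ℝ (Matrix (Fin d) (Fin d) ℝ)} (hν : ∀ X, ν X = 0 → X = 0) (hp₀ : p ≠ 0)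
    (hp : Even p ∨ ∃ K : Set (Fin d → ℝ), IsProperCone K ∧ ∀ i, LeavesInvariant (M i) K) :
    ∃ l : Fin N → ℝ, (∀ s, HasGrowthRate (fun k => normMoment P M ν p k s) (l s)) ∧
      IsGreatest (Set.range l) (specRadius (transferMatrix P M p)) := by
  obtain ⟨S, hM, Φ, hΦ⟩ := exists_submonoid_seminorm_pow_le_dual_kronPow hp₀ hp ν
  obtain ⟨l, hl, hmax⟩ := exists_isGreatest_hasGrowthRate_matrix_pow_mul
    (swappedTransferMatrix P M p) (blockProj N d p) (sum_blockProj N d p)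
  rw [specRadius_swappedTransferMatrix] at hmax
  exact ⟨l, fun s => (hl s).of_isTheta
    ⟨normMoment_isBigO_swappedTransferMatrix_pow hP hM hΦ s,
      swappedTransferMatrix_pow_isBigO_normMoment hP hν s⟩, hmax⟩

end NormMoments

section InitialState

variable {N d : ℕ} {P : Matrix (Fin N) (Fin N) ℝ} {M : Fin N → Matrix (Fin d) (Fin d) ℝ} {p : ℕ}
  {ν : Seminorm ℝ (Matrix (Fin d) (Fin d) ℝ)}

theorem normMoment_succ (P : Matrix (Fin N) (Fin N) ℝ) (M : Fin N → Matrix (Fin d) (Fin d) ℝ)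
    (ν : Seminorm ℝ (Matrix (Fin d) (Fin d) ℝ)) (p k : ℕ) (s : Fin N) :
    normMoment P M ν p (k + 1) s =
      ∑ j, P s j * pathExpectation P M (fun X _ => ν (X * M j) ^ p) k j := by
  simp only [normMoment, pathExpectation, pow_succ', Module.End.mul_apply, transitionOp_apply,
    mul_one]
  refine Finset.sum_congr rfl fun j _ => congrArg _ ?_
  rw [transitionOp_pow_mul_right M fun X _ => ν X ^ p, one_mul]

theorem pathExpectation_seminorm_mul_pow_nonneg (hP : ∀ i j, 0 ≤ P i j)
    (ν : Seminorm ℝ (Matrix (Fin d) (Fin d) ℝ)) (Y : Matrix (Fin d) (Fin d) ℝ) (k : ℕ)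
    (s : Fin N) : 0 ≤ pathExpectation P M (fun X _ => ν (X * Y) ^ p) k s :=
  transitionOp_pow_nonneg hP (fun _ _ => pow_nonneg (apply_nonneg ν _) p) k 1 s

theorem mul_pathExpectation_le_normMoment_succ (hP : ∀ i j, 0 ≤ P i j) (s t : Fin N) (k : ℕ) :
    P s t * pathExpectation P M (fun X _ => ν (X * M t) ^ p) k t ≤
      normMoment P M ν p (k + 1) s := by
  rw [normMoment_succ]
  exact Finset.single_le_sum
    (f := fun j => P s j * pathExpectation P M (fun X _ => ν (X * M j) ^ p) k j)
    (fun j _ => mul_nonneg (hP s j) (pathExpectation_seminorm_mul_pow_nonneg hP ν _ k j))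
    (Finset.mem_univ t)

theorem pathExpectation_isBigO_normMoment_succ (hP : ∀ i j, 0 ≤ P i j) {s t : Fin N}
    (hst : 0 < P s t) :
    (fun k => pathExpectation P M (fun X _ => ν (X * M t) ^ p) k t) =O[atTop]
      fun k => normMoment P M ν p (k + 1) s := by
  refine .of_bound (P s t)⁻¹ (.of_forall fun k => ?_)
  rw [Real.norm_of_nonneg (pathExpectation_seminorm_mul_pow_nonneg hP ν _ k t),
    Real.norm_of_nonneg (normMoment_nonneg hP ν (k + 1) s), le_inv_mul_iff₀ hst]
  exact mul_pathExpectation_le_normMoment_succ hP s t k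

theorem HasGrowthRate.normMoment_le_of_pos (hP : ∀ i j, 0 < P i j) {s t : Fin N} {l m : ℝ}
    (hs : HasGrowthRate (fun k => normMoment P M ν p k s) l)
    (ht : HasGrowthRate (fun k => normMoment P M ν p k t) m) : l ≤ m := by
  refine hs.comp_add_one.le_of_isBigO ht.comp_add_one ?_
  simp only [normMoment_succ _ _ _ _ _ s]
  exact .fun_sum fun j _ =>
    (pathExpectation_isBigO_normMoment_succ (fun i j => (hP i j).le) (hP t j)).const_mul_left _

theorem normMoment_isBigO_pathExpectation_mul (hP : ∀ i j, 0 ≤ P i j)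
    (hν : ∀ X, ν X = 0 → X = 0) {A : Matrix (Fin d) (Fin d) ℝ} (hA : IsUnit A) (t : Fin N) :
    (fun k => normMoment P M ν p k t) =O[atTop]
      fun k => pathExpectation P M (fun X _ => ν (X * A) ^ p) k t := by
  obtain ⟨C, hC⟩ := exists_seminorm_le_mul_seminorm_mul ν hν hA
  refine .of_bound (C ^ p) (.of_forall fun k => ?_)
  rw [Real.norm_of_nonneg (normMoment_nonneg hP ν k t),
    Real.norm_of_nonneg (pathExpectation_seminorm_mul_pow_nonneg hP ν A k t)]
  have hle : (fun X _ => ν X ^ p : Matrix (Fin d) (Fin d) ℝ → Fin N → ℝ) ≤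
      C ^ p • fun X _ => ν (X * A) ^ p := fun X _ => by
    simpa only [Pi.smul_apply, smul_eq_mul, mul_pow] using
      pow_le_pow_left₀ (apply_nonneg ν X) (hC X) p
  have h := transitionOp_pow_mono (M := M) hP hle k
  rw [map_smul] at h
  exact h 1 t

theorem HasGrowthRate.normMoment_le_of_step (hP : ∀ i j, 0 ≤ P i j) (hν : ∀ X, ν X = 0 → X = 0)
    {s t : Fin N} (hst : 0 < P s t) (hM : IsUnit (M t)) {l m : ℝ}
    (hs : HasGrowthRate (fun k => normMoment P M ν p k s) l)
    (ht : HasGrowthRate (fun k => normMoment P M ν p k t) m) : m ≤ l :=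
  ht.le_of_isBigO hs.comp_add_one <| (normMoment_isBigO_pathExpectation_mul hP hν hM t).trans
    (pathExpectation_isBigO_normMoment_succ hP hst)

theorem le_of_matrix_pow_pos {ι α : Type*} [Fintype ι] [DecidableEq ι] [Preorder α]
    {Q : Matrix ι ι ℝ} (hQ : ∀ i j, 0 ≤ Q i j) {l : ι → α}
    (hl : ∀ i j, 0 < Q i j → l j ≤ l i) (n : ℕ) {i j : ι} (hij : 0 < (Q ^ n) i j) :
    l j ≤ l i := by
  induction n generalizing i with
  | zero =>
    obtain rfl : i = j := by
      by_contra hne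
      simp [hne] at hij
    exact le_rfl
  | succ n ih =>
    rw [pow_succ', Matrix.mul_apply] at hij
    obtain ⟨k, -, hk⟩ : ∃ k ∈ Finset.univ, 0 < Q i k * (Q ^ n) k j := by
      by_contra! h
      exact hij.not_ge (Finset.sum_nonpos h)
    have hik : 0 < Q i k := (hQ i k).lt_of_ne fun h => by simp [← h] at hk
    exact (ih (pos_of_mul_pos_right hk hik.le)).trans (hl i k hik)

theorem normMoment_growthRate_const (hP : ∀ i j, 0 ≤ P i j) (hν : ∀ X, ν X = 0 → X = 0)
    (h : (∀ i j, 0 < P i j) ∨ ((∀ i j, ∃ n : ℕ, 0 < (P ^ n) i j) ∧ ∀ i, IsUnit (M i)))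
    {l : Fin N → ℝ} (hl : ∀ s, HasGrowthRate (fun k => normMoment P M ν p k s) (l s))
    (s t : Fin N) : l s = l t := by
  suffices ∀ s t, l s ≤ l t from le_antisymm (this s t) (this t s)
  intro s t
  obtain hpos | ⟨hirr, hM⟩ := h
  · exact (hl s).normMoment_le_of_pos hpos (hl t)
  · obtain ⟨n, hn⟩ := hirr t s
    exact le_of_matrix_pow_pos hP
      (fun i j hij => (hl i).normMoment_le_of_step hP hν hij (hM j) (hl j)) n hn

end InitialState

theorem IsMarkovChain.tendsto_pRadiusSeq {N d : ℕ} {P : Matrix (Fin N) (Fin N) ℝ}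
    (hP : ∀ i j, 0 ≤ P i j) {M : Fin N → Matrix (Fin d) (Fin d) ℝ}
    {ν : Seminorm ℝ (Matrix (Fin d) (Fin d) ℝ)} {p : ℕ} {s₀ : Fin N} {Ω : Type*}
    [MeasurableSpace Ω] {μ : Measure Ω} [IsProbabilityMeasure μ] {σ : ℕ → Ω → Fin N}
    (hσ : IsMarkovChain P s₀ μ σ) {l : ℝ}
    (hl : HasGrowthRate (fun k => normMoment P M ν p k s₀) l) :
    Tendsto (pRadiusSeq ν p μ fun k ω => M (σ k ω)) atTop (𝓝 (l ^ (1 / (p : ℝ)))) := by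
  refine (Tendsto.rpow_const hl (.inr (by positivity))).congr fun k => ?_
  rw [pRadiusSeq, hσ.integral_revProd M (fun X _ => ν X ^ p) k,
    Real.norm_of_nonneg (normMoment_nonneg hP ν k s₀),
    ← Real.rpow_mul (normMoment_nonneg hP ν k s₀), one_div_mul_one_div, mul_comm, normMoment]

end MarkovSwitched

open MarkovSwitched in
theorem mainTheorem7_general {N d : ℕ} (hN : 0 < N) (P : Matrix (Fin N) (Fin N) ℝ)
    (hP : ∀ i j, 0 ≤ P i j) (M : Fin N → Matrix (Fin d) (Fin d) ℝ) (p : ℕ) (hp₀ : p ≠ 0)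
    (hp : Even p ∨ ∃ K : Set (Fin d → ℝ), IsProperCone K ∧ ∀ i, LeavesInvariant (M i) K)
    (ν : Seminorm ℝ (Matrix (Fin d) (Fin d) ℝ)) (hν : ∀ X, ν X = 0 → X = 0)
    (Ω : Fin N → Type*) [∀ s₀, MeasurableSpace (Ω s₀)]
    (μ : ∀ s₀, Measure (Ω s₀)) [∀ s₀, IsProbabilityMeasure (μ s₀)]
    (σ : ∀ s₀, ℕ → Ω s₀ → Fin N) (hσ : ∀ s₀, IsMarkovChain P s₀ (μ s₀) (σ s₀)) :
    (∀ s₀, Tendsto (pRadiusSeq ν p (μ s₀) fun k ω => M (σ s₀ k ω)) atTop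
      (𝓝 (pRadius ν p (μ s₀) fun k ω => M (σ s₀ k ω)))) ∧
    IsGreatest (Set.range fun s₀ => pRadius ν p (μ s₀) fun k ω => M (σ s₀ k ω))
      (specRadius (transferMatrix P M p) ^ (1 / (p : ℝ))) ∧
    ((∀ i j, 0 < P i j) ∨ ((∀ i j, ∃ n : ℕ, 0 < (P ^ n) i j) ∧ ∀ i, IsUnit (M i)) →
      ∀ s₀, (pRadius ν p (μ s₀) fun k ω => M (σ s₀ k ω)) =
        specRadius (transferMatrix P M p) ^ (1 / (p : ℝ))) := by
  have : NeZero N := ⟨hN.ne'⟩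
  obtain ⟨l, hl, hmax⟩ := exists_isGreatest_hasGrowthRate_normMoment hP hν hp₀ hp
  have hlim : ∀ s₀, Tendsto (pRadiusSeq ν p (μ s₀) fun k ω => M (σ s₀ k ω)) atTop
      (𝓝 (l s₀ ^ (1 / (p : ℝ)))) := fun s₀ => (hσ s₀).tendsto_pRadiusSeq hP (hl s₀)
  have hrad : ∀ s₀, (pRadius ν p (μ s₀) fun k ω => M (σ s₀ k ω)) = l s₀ ^ (1 / (p : ℝ)) :=
    fun s₀ => (hlim s₀).limUnder_eq
  simp only [hrad]
  obtain ⟨⟨s, hs⟩, hle⟩ := hmax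
  refine ⟨hlim, ⟨⟨s, by simp only [hs]⟩, ?_⟩, fun h s₀ => ?_⟩
  · rintro _ ⟨t, rfl⟩
    exact Real.rpow_le_rpow (hl t).nonneg (hle ⟨t, rfl⟩) (by positivity)
  · rw [← hs, normMoment_growthRate_const hP hν h hl s₀ s]

theorem mainTheorem7 {N d : ℕ} (hN : 0 < N)
    (P : Matrix (Fin N) (Fin N) ℝ)
    (hP_nonneg : ∀ i j, 0 ≤ P i j) (hP_sum : ∀ i, ∑ j, P i j = 1)
    (M : Fin N → Matrix (Fin d) (Fin d) ℝ)
    (p : ℕ)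
    (hp : p = 2 ∨
      (p = 1 ∧ ∃ K : Set (Fin d → ℝ), MarkovSwitched.IsProperCone K ∧
        ∀ i, MarkovSwitched.LeavesInvariant (M i) K))
    -- an arbitrary norm on the space of matrices
    (ν : Seminorm ℝ (Matrix (Fin d) (Fin d) ℝ)) (hν : ∀ X, ν X = 0 → X = 0)
    -- for each initial state, a realization of the Markov chain started there
    (Ω : Fin N → Type*) [∀ s₀, MeasurableSpace (Ω s₀)]
    (μ : ∀ s₀, Measure (Ω s₀)) [∀ s₀, IsProbabilityMeasure (μ s₀)]
    (σ : ∀ s₀, ℕ → Ω s₀ → Fin N)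
    (hσ : ∀ s₀, MarkovSwitched.IsMarkovChain P s₀ (μ s₀) (σ s₀)) :
    -- the limit defining the `p`-radius exists for every initial state
    (∀ s₀, Tendsto (MarkovSwitched.pRadiusSeq ν p (μ s₀) (fun k ω => M (σ s₀ k ω))) atTop
      (𝓝 (MarkovSwitched.pRadius ν p (μ s₀) (fun k ω => M (σ s₀ k ω))))) ∧
    -- its maximum over the initial states
    IsGreatest
      (Set.range fun s₀ => MarkovSwitched.pRadius ν p (μ s₀) (fun k ω => M (σ s₀ k ω)))
      (MarkovSwitched.specRadius (MarkovSwitched.transferMatrix P M p) ^ (1 / (p : ℝ))) ∧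
    -- its value for each initial state, when the choice of that state is immaterial
    ((∀ i j, 0 < P i j) ∨ ((∀ i j, ∃ n : ℕ, 0 < (P ^ n) i j) ∧ ∀ i, IsUnit (M i)) →
      ∀ s₀, MarkovSwitched.pRadius ν p (μ s₀) (fun k ω => M (σ s₀ k ω)) =
        MarkovSwitched.specRadius (MarkovSwitched.transferMatrix P M p) ^ (1 / (p : ℝ))) :=
  mainTheorem7_general hN P hP_nonneg M p (by lia)
    (hp.imp (fun h : p = 2 => h ▸ even_two) And.right) ν hν Ω μ σ hσ
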